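/- **Theorem 2.** Let $\mathcal X$ be a measurable space, $\mathcal Y\subseteq\mathbb R$ a label space, $\mathcal F$ a class of measurable functions $f:\mathcal X\to\mathbb R$, and $\ell:\mathbb R\times\mathbb R\to[0,\infty)$ a regression loss (such as the squared or the absolute error), that is: $\ell(y,y)=0$; $\ell(a,y)<\ell(a',y')$ whenever $a'\le a\le y\le y'$ or $y'\le y\le a\le a'$ with $(a,y)\ne(a',y')$; $\ell$ is locally Lipschitz on $\mathbb R^2$; and $\ell(a,y)\to\infty$ as $|a|\to\infty$ for fixed $y$, and as $|y|\to\infty$ for fixed $a$. For a finite nonempty set $S\subset\mathbb R$ of candidate labels put $\ell_{\min}(a,S)=\min_{y\in S}\ell(a,y)$. Assume that the class $\{x\mapsto \ell(f(x),y)\mid f\in\mathcal F,\ y\in\mathcal Y\}$ has finite pseudo-dimension and that $|\ell(f(x),y)|\le M<\infty$ for all $f\in\mathcal F$, $x\in\mathcal X$, $y\in\mathcal Y$. Then there is a constant $C>0$, depending only on $\ell,\mathcal F,\mathcal Y,M$, such that the following holds. Let $P$ be any law of a triple $(x,y,S)$ of an instance, its true label and its finite candidate label set with $y\in S\subseteq\mathcal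 Y$ almost surely, and put $R(f)=\mathbb E[\ell(f(x),y)]$ and $R_{\min}(f)=\mathbb E[\ell_{\min}(f(x),S)]$. Let $f^\star\in\arg\min_{f\in\mathcal F}R(f)$ satisfy $R(f^\star)=0$. Let $n\ge1$, let $(x_1,S_1),\dots,(x_n,S_n)$ be independent copies of $(x,S)$, and let $\widehat f_{\min}$ be an empirical risk minimizer, i.e. almost surely $$\widehat f_{\min}\in\arg\min_{f\in\mathcal F}\frac1n\sum_{i=1}^n\ell_{\min}(f(x_i),S_i),$$ chosen as a function of the sample so that its prediction at $x$ is jointly measurable in the sample and $x$. Then for every $\delta\in(0,1)$, with probability at least $1-\delta$, $$\bigl|R_{\min}(\widehat f_{\min})-R_{\min}(f^\star)\bigr|\le \frac{C\,\bigl(1+\sqrt{\log(1/\delta)}\bigr)}{\sqrt n}.$$ -/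

import Mathlib

open MeasureTheory

/-- Regression losses `ℓ (prediction) (label)`, such as the squared and the absolute error (also the
Huber, log-cosh and pinball losses): nonnegative, zero at a perfect prediction, strictly larger
whenever the interval between prediction and label is enlarged (on the same side), locally
Lipschitz, and unbounded as the prediction moves away from a fixed label or conversely. -/
structure IsRegressionLoss (ℓ : ℝ → ℝ → ℝ) : Prop where
  nonneg : ∀ a y, 0 ≤ ℓ a y
  self_eq_zero : ∀ y, ℓ y y = 0
  lt_of_under : ∀ a y a' y', a' ≤ a → a ≤ y → y ≤ y' → (a, y) ≠ (a', y') → ℓ a y < ℓ a' y'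
  lt_of_over : ∀ a y a' y', y' ≤ y → y ≤ a → a ≤ a' → (a, y) ≠ (a', y') → ℓ a y < ℓ a' y'
  locallyLipschitz : LocallyLipschitz fun p : ℝ × ℝ => ℓ p.1 p.2
  tendsto_prediction : ∀ y, Filter.Tendsto (fun a => ℓ a y) (Filter.cocompact ℝ) Filter.atTop
  tendsto_label : ∀ a, Filter.Tendsto (fun y => ℓ a y) (Filter.cocompact ℝ) Filter.atTop

/-- `H` pseudo-shatters the finite set `s`: for some thresholds `t`, every subset of `s` is cut out
as the points of `s` at which some `h ∈ H` exceeds its threshold. -/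
def PseudoShatters {𝒳 : Type*} (H : Set (𝒳 → ℝ)) (s : Finset 𝒳) : Prop :=
  ∃ t : 𝒳 → ℝ, ∀ b ⊆ s, ∃ h ∈ H, ∀ x ∈ s, t x < h x ↔ x ∈ b

/-- The pseudo-dimension: the supremum of the sizes of pseudo-shattered finite sets. -/
noncomputable def pseudoDim {𝒳 : Type*} (H : Set (𝒳 → ℝ)) : ℕ∞ :=
  ⨆ (s : Finset 𝒳) (_ : PseudoShatters H s), (s.card : ℕ∞)

/-- The class `{x ↦ ℓ (f x) y | f ∈ F, y ∈ 𝒴}`. -/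
def lossClass {𝒳 : Type*} (ℓ : ℝ → ℝ → ℝ) (F : Set (𝒳 → ℝ)) (𝒴 : Set ℝ) : Set (𝒳 → ℝ) :=
  {h | ∃ f ∈ F, ∃ y ∈ 𝒴, h = fun x => ℓ (f x) y}

/-- A finite set of real candidate labels. (A wrapper around `Finset ℝ`, so that it can carry the
σ-algebra below, not the one Mathlib puts on `Finset`.) -/
structure CandidateSet where
  labels : Finset ℝ

/-- The σ-algebra on candidate sets generated by the events "`S` meets the open set `U`"; on nonempty
sets it is the Borel σ-algebra of the Hausdorff distance. -/
instance : MeasurableSpace CandidateSet :=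
  MeasurableSpace.generateFrom
    {A | ∃ U : Set ℝ, IsOpen U ∧ A = {S : CandidateSet | ∃ y ∈ S.labels, y ∈ U}}

open Classical in
/-- `ℓ_min(a, S) = min_{y ∈ S} ℓ(a, y)` (with value `0` for the empty set, which has probability
zero below). -/
noncomputable def minLoss (ℓ : ℝ → ℝ → ℝ) (a : ℝ) (S : CandidateSet) : ℝ :=
  if hS : S.labels.Nonempty then S.labels.inf' hS (fun y => ℓ a y) else 0

/-- The law of the observed pair `(x, S)` when `P` is the law of `(x, y, S)`. -/
noncomputable def observedLaw {𝒳 : Type*} [MeasurableSpace 𝒳]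
    (P : Measure (𝒳 × ℝ × CandidateSet)) : Measure (𝒳 × CandidateSet) :=
  P.map fun z => (z.1, z.2.2)

/-- The ordinary risk `R(f) = E[ℓ(f(x), y)]`. -/
noncomputable def risk {𝒳 : Type*} [MeasurableSpace 𝒳] (ℓ : ℝ → ℝ → ℝ)
    (P : Measure (𝒳 × ℝ × CandidateSet)) (f : 𝒳 → ℝ) : ℝ :=
  ∫ z, ℓ (f z.1) z.2.1 ∂P

/-- The risk of the identification method, `R_min(f) = E[ℓ_min(f(x), S)]`. -/
noncomputable def minRisk {𝒳 : Type*} [MeasurableSpace 𝒳] (ℓ : ℝ → ℝ → ℝ)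
    (P : Measure (𝒳 × ℝ × CandidateSet)) (f : 𝒳 → ℝ) : ℝ :=
  ∫ z, minLoss ℓ (f z.1) z.2 ∂(observedLaw P)

/-- The empirical risk of the identification method on the sample `(x₁, S₁), …, (xₙ, Sₙ)`. -/
noncomputable def empMinRisk {𝒳 : Type*} {n : ℕ} (ℓ : ℝ → ℝ → ℝ)
    (z : Fin n → 𝒳 × CandidateSet) (f : 𝒳 → ℝ) : ℝ :=
  (1 / (n : ℝ)) * ∑ i, minLoss ℓ (f (z i).1) (z i).2

/-- `f` minimizes `J` over the model class `F`. -/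
def IsArgMin {𝒳 : Type*} (J : (𝒳 → ℝ) → ℝ) (F : Set (𝒳 → ℝ)) (f : 𝒳 → ℝ) : Prop :=
  f ∈ F ∧ ∀ g ∈ F, J f ≤ J g

/-- `P` is a law of `(x, y, S)` for partial-label regression with label space `𝒴`: a probability
measure under which, almost surely, `S ⊆ 𝒴` and the true label `y` belongs to `S`. -/
structure IsPLRLaw {𝒳 : Type*} [MeasurableSpace 𝒳] (𝒴 : Set ℝ)
    (P : Measure (𝒳 × ℝ × CandidateSet)) : Prop where
  isProbabilityMeasure : IsProbabilityMeasure P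
  ae_subset : ∀ᵐ z ∂P, ∀ y ∈ z.2.2.labels, y ∈ 𝒴
  ae_mem : ∀ᵐ z ∂P, z.2.1 ∈ z.2.2.labels

/-! Since `y ∈ S` almost surely, the minimum loss of a model is at most its true loss, so zero risk
of `fstar` forces its minimum loss to vanish almost surely. Hence the empirical minimizer has zero
minimum loss at every sample point. In this realizable setting a ghost sample yields an exponential
moment, `E exp(n R_min(fhat) / (3B)) ≤ e² N`, where `N` bounds the size of a cover of the model
class at scale `1 / n` on the double sample (`lintegral_exp_risk_le`). Markov's inequality then
gives a rate of order `(log N + log (1/δ)) / n`, which is more than is claimed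
(`exists_rate_const`).

Candidate sets have no bounded size, so a useful cover must control the loss at all labels at once.
The point is that two labels suffice (`IsRegressionLoss.exists_thresholds`): on one side of a label
the loss is strictly monotone in the prediction, so it locates the prediction, and the second label
excludes confusion between the two sides. Local Lipschitz continuity carries this to every label.
Sauer's lemma at these two labels then makes `N` polynomial in `n`
(`IsRegressionLoss.exists_cover`). -/

/-! ### The minimum loss and its measurability -/

theorem IsRegressionLoss.continuous {ℓ : ℝ → ℝ → ℝ} (hℓ : IsRegressionLoss ℓ) :
    Continuous fun p : ℝ × ℝ => ℓ p.1 p.2 := hℓ.locallyLipschitz.continuous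

theorem minLoss_nonneg {ℓ : ℝ → ℝ → ℝ} (hℓ : ∀ a y, 0 ≤ ℓ a y) (a : ℝ) (S : CandidateSet) :
    0 ≤ minLoss ℓ a S := by
  unfold minLoss
  split_ifs with h
  · exact (Finset.le_inf'_iff _ _).2 fun y _ => hℓ a y
  · exact le_rfl

theorem minLoss_le {ℓ : ℝ → ℝ → ℝ} {a y : ℝ} {S : CandidateSet} (hy : y ∈ S.labels) :
    minLoss ℓ a S ≤ ℓ a y := by
  unfold minLoss
  rw [dif_pos ⟨y, hy⟩]
  exact Finset.inf'_le _ hy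

theorem minLoss_lt_iff {ℓ : ℝ → ℝ → ℝ} {a t : ℝ} {S : CandidateSet} (hS : S.labels.Nonempty) :
    minLoss ℓ a S < t ↔ ∃ y ∈ S.labels, ℓ a y < t := by
  unfold minLoss
  rw [dif_pos hS, Finset.inf'_lt_iff]

theorem minLoss_le_minLoss_add {ℓ : ℝ → ℝ → ℝ} {a b η : ℝ} {S : CandidateSet} (hη : 0 ≤ η)
    (h : ∀ y ∈ S.labels, |ℓ a y - ℓ b y| ≤ η) : minLoss ℓ a S ≤ minLoss ℓ b S + η := by
  by_cases hS : S.labels.Nonempty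
  · obtain ⟨y, hy, he⟩ := S.labels.exists_mem_eq_inf' hS (fun y => ℓ b y)
    have hb : minLoss ℓ b S = ℓ b y := by rw [minLoss, dif_pos hS, he]
    rw [hb]
    have := minLoss_le (ℓ := ℓ) (a := a) hy
    have := (abs_le.1 (h y hy)).2
    linarith
  · simp [minLoss, hS, hη]

theorem measurableSet_labels_meet {U : Set ℝ} (hU : IsOpen U) :
    MeasurableSet {S : CandidateSet | ∃ y ∈ S.labels, y ∈ U} :=
  MeasurableSpace.measurableSet_generateFrom ⟨U, hU, rfl⟩

theorem measurableSet_labels_nonempty : MeasurableSet {S : CandidateSet | S.labels.Nonempty} := by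
  simpa [Finset.Nonempty] using measurableSet_labels_meet isOpen_univ

theorem measurableSet_labels_subset {s : Set ℝ} (hs : IsClosed s) :
    MeasurableSet {S : CandidateSet | ∀ y ∈ S.labels, y ∈ s} := by
  convert (measurableSet_labels_meet hs.isOpen_compl).compl using 1
  ext S
  simp

/-- A countable base of open rectangles writes the event as a countable union of products of
generating events. -/
theorem measurableSet_prod_labels_meet {U : Set (ℝ × ℝ)} (hU : IsOpen U) :
    MeasurableSet {p : ℝ × CandidateSet | ∃ y ∈ p.2.labels, (p.1, y) ∈ U} := by
  have hB := TopologicalSpace.isBasis_countableBasis ℝ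
  set B := TopologicalSpace.countableBasis ℝ
  have hBc : B.Countable := TopologicalSpace.countable_countableBasis ℝ
  have key : {p : ℝ × CandidateSet | ∃ y ∈ p.2.labels, (p.1, y) ∈ U} =
      ⋃ q ∈ {q : Set ℝ × Set ℝ | (q.1 ∈ B ∧ q.2 ∈ B) ∧ q.1 ×ˢ q.2 ⊆ U},
        q.1 ×ˢ {S : CandidateSet | ∃ y ∈ S.labels, y ∈ q.2} := by
    ext ⟨a, S⟩
    simp only [Set.mem_ofPred_eq, Set.mem_iUnion, Set.mem_prod, exists_prop, Prod.exists]
    constructor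
    · rintro ⟨y, hy, hU'⟩
      obtain ⟨W, hW, haW, hWU⟩ := (hB.prod hB).exists_subset_of_mem_open hU' hU
      obtain ⟨u, hu, v, hv, rfl⟩ := hW
      exact ⟨u, v, ⟨⟨hu, hv⟩, hWU⟩, haW.1, y, hy, haW.2⟩
    · rintro ⟨u, v, ⟨_, hWU⟩, hau, y, hy, hyv⟩
      exact ⟨y, hy, hWU ⟨hau, hyv⟩⟩
  rw [key]
  refine MeasurableSet.biUnion ?_ fun q hq => ?_
  · exact (hBc.prod hBc).mono fun q hq => hq.1
  · exact (hB.isOpen hq.1.1).measurableSet.prod (measurableSet_labels_meet (hB.isOpen hq.1.2))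

theorem measurable_minLoss {ℓ : ℝ → ℝ → ℝ} (hℓ : Continuous fun p : ℝ × ℝ => ℓ p.1 p.2) :
    Measurable fun p : ℝ × CandidateSet => minLoss ℓ p.1 p.2 := by
  refine measurable_of_Iio fun t => ?_
  have hne : MeasurableSet {p : ℝ × CandidateSet | p.2.labels.Nonempty} :=
    measurable_snd measurableSet_labels_nonempty
  have key : (fun p : ℝ × CandidateSet => minLoss ℓ p.1 p.2) ⁻¹' Set.Iio t =
      ({p | p.2.labels.Nonempty} ∩ {p | ∃ y ∈ p.2.labels, (p.1, y) ∈ {q : ℝ × ℝ | ℓ q.1 q.2 < t}}) ∪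
      ({p | p.2.labels.Nonempty}ᶜ ∩ {_p | 0 < t}) := by
    ext ⟨a, S⟩
    by_cases hS : S.labels.Nonempty
    · simp [hS, minLoss_lt_iff hS]
    · simp [hS, minLoss]
  rw [key]
  exact (hne.inter (measurableSet_prod_labels_meet (isOpen_lt hℓ continuous_const))).union
    (hne.compl.inter (MeasurableSet.const _))

/-! ### Two labels determine the losses at all labels -/

theorem exists_grid (B q : ℕ) (hq : 1 ≤ q) :
    ∃ G : Finset ℝ, G.card ≤ 2 * B * q + 1 ∧
      ∀ u v : ℝ, -(B : ℝ) ≤ u → v ≤ B → u + 1 / q < v → ∃ s ∈ G, u < s ∧ s < v := by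
  classical
  have hq0 : (0 : ℝ) < q := by exact_mod_cast hq
  refine ⟨(Finset.range (2 * B * q + 1)).image fun j : ℕ => -(B : ℝ) + j / q,
    Finset.card_image_le.trans (by simp), fun u v hu hv huv => ?_⟩
  have h0 : 0 ≤ (u + B) * q := mul_nonneg (by linarith) hq0.le
  have h1 := Nat.floor_le h0
  have h2 := Nat.lt_floor_add_one ((u + B) * q)
  set j := ⌊(u + B) * q⌋₊
  have h3 : u < -(B : ℝ) + (j + 1 : ℕ) / q := by
    have : u + B < (j + 1 : ℕ) / q := by rw [lt_div_iff₀ hq0]; push_cast; exact h2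
    linarith
  have h4 : -(B : ℝ) + (j + 1 : ℕ) / q < v := by
    have : (j : ℝ) / q ≤ u + B := by rw [div_le_iff₀ hq0]; exact h1
    push_cast
    rw [add_div]
    linarith
  -- Index `j + 1`, not `j`: it gives the first grid point strictly above `u`.
  refine ⟨_, Finset.mem_image.2 ⟨j + 1, ?_, rfl⟩, h3, h4⟩
  rw [Finset.mem_range]
  have h5 : ((j + 1 : ℕ) : ℝ) / q < 2 * B := by linarith
  rw [div_lt_iff₀ hq0] at h5
  have : j + 1 < 2 * B * q := by exact_mod_cast h5
  omega

/-- Coercivity in the label at the fixed prediction `a₀` bounds the label space; coercivity in the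
prediction at `y₀` bounds the predictions. Everything then happens on a compact square. -/
theorem IsRegressionLoss.exists_bound {ℓ : ℝ → ℝ → ℝ} (hℓ : IsRegressionLoss ℓ) {𝒴 : Set ℝ}
    {M a₀ y₀ : ℝ} (ha₀ : ∀ y ∈ 𝒴, ℓ a₀ y ≤ M) :
    ∃ B : ℕ, M ≤ B ∧ (∀ y ∈ 𝒴, |y| ≤ B) ∧ ∀ a, ℓ a y₀ ≤ M → |a| ≤ B := by
  have aux : ∀ f : ℝ → ℝ, Filter.Tendsto f (Filter.cocompact ℝ) Filter.atTop →
      ∃ r : ℝ, ∀ a, f a ≤ M → |a| ≤ r := by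
    intro f hf
    obtain ⟨K, hK, hKs⟩ := Filter.mem_cocompact.1 (hf.eventually_gt_atTop M)
    obtain ⟨r, hr⟩ := hK.isBounded.exists_norm_le
    refine ⟨r, fun a ha => ?_⟩
    by_contra hcon
    have : a ∉ K := fun haK => hcon (hr a haK)
    exact absurd (hKs this) (not_lt.2 ha)
  obtain ⟨r₁, hr₁⟩ := aux _ (hℓ.tendsto_label a₀)
  obtain ⟨r₂, hr₂⟩ := aux _ (hℓ.tendsto_prediction y₀)
  obtain ⟨B, hB⟩ := exists_nat_ge (max M (max r₁ r₂))
  simp only [max_le_iff] at hB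
  exact ⟨B, hB.1, fun y hy => (hr₁ y (ha₀ y hy)).trans hB.2.1,
    fun a ha => (hr₂ a ha).trans hB.2.2⟩

theorem IsRegressionLoss.lt_of_mem_left {ℓ : ℝ → ℝ → ℝ} (hℓ : IsRegressionLoss ℓ) {a s y : ℝ}
    (h : a < s) (h' : s ≤ y) : ℓ s y < ℓ a y :=
  hℓ.lt_of_under s y a y h.le h' le_rfl fun he => h.ne' (Prod.ext_iff.1 he).1

theorem IsRegressionLoss.lt_of_mem_right {ℓ : ℝ → ℝ → ℝ} (hℓ : IsRegressionLoss ℓ) {b s y : ℝ}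
    (h : s < b) (h' : y ≤ s) : ℓ s y < ℓ b y :=
  hℓ.lt_of_over s y b y le_rfl h' h.le fun he => h.ne (Prod.ext_iff.1 he).1

/-- Two predictions on the same side of the label `y` that are not separated by the losses of the
points of a grid are closer than the mesh of the grid. -/
theorem IsRegressionLoss.sub_le_of_grid {ℓ : ℝ → ℝ → ℝ} (hℓ : IsRegressionLoss ℓ) {G : Set ℝ}
    {a b y r : ℝ} (hG : a + r < b → ∃ s ∈ G, a < s ∧ s < b)
    (hpat : ∀ s ∈ G, (ℓ s y < ℓ a y ↔ ℓ s y < ℓ b y)) (hside : y ≤ a ∨ b ≤ y) : b - a ≤ r := by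
  by_contra hcon
  obtain ⟨s, hs, h1, h2⟩ := hG (by linarith)
  rcases hside with h | h
  · have := (hpat s hs).2 (hℓ.lt_of_mem_right h2 (h.trans h1.le))
    exact absurd this (not_lt.2 (hℓ.lt_of_mem_right h1 h).le)
  · have := (hpat s hs).1 (hℓ.lt_of_mem_left h1 (h2.le.trans h))
    exact absurd this (not_lt.2 (hℓ.lt_of_mem_left h2 h).le)

theorem abs_sub_le_of_grid {G : Set ℝ} {u v r B : ℝ}
    (hG : ∀ u v : ℝ, -B ≤ u → v ≤ B → u + r < v → ∃ s ∈ G, u < s ∧ s < v)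
    (hu : |u| ≤ B) (hv : |v| ≤ B) (hpat : ∀ s ∈ G, (s < u ↔ s < v)) : |u - v| ≤ r := by
  rw [abs_le] at hu hv ⊢
  constructor <;> by_contra hcon
  · obtain ⟨s, hs, h1, h2⟩ := hG u v hu.1 hv.2 (by linarith)
    exact absurd ((hpat s hs).2 h2) (not_lt.2 h1.le)
  · obtain ⟨s, hs, h1, h2⟩ := hG v u hv.1 hu.2 (by linarith)
    exact absurd ((hpat s hs).1 h2) (not_lt.2 h1.le)

/-- On the label space `𝒴`, the losses of a bounded prediction are known up to `1 / m` once the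
losses at two labels are compared with `O(m)` thresholds. -/
theorem IsRegressionLoss.exists_thresholds {ℓ : ℝ → ℝ → ℝ} (hℓ : IsRegressionLoss ℓ) {𝒴 : Set ℝ}
    (h𝒴 : 𝒴.Nonempty) {M : ℝ} (hM : ∃ a, ∀ y ∈ 𝒴, ℓ a y ≤ M) :
    ∃ y₀ ∈ 𝒴, ∃ y₁ ∈ 𝒴, ∃ A : ℕ, ∀ m : ℕ, 1 ≤ m → ∃ T : Finset ℝ, T.card ≤ A * m ∧
      ∀ a b : ℝ, (∀ y ∈ 𝒴, ℓ a y ≤ M) → (∀ y ∈ 𝒴, ℓ b y ≤ M) →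
        (∀ t ∈ T, (t < ℓ a y₀ ↔ t < ℓ b y₀)) → (∀ t ∈ T, (t < ℓ a y₁ ↔ t < ℓ b y₁)) →
        ∀ y ∈ 𝒴, |ℓ a y - ℓ b y| ≤ 1 / m := by
  classical
  obtain ⟨a₀, ha₀⟩ := hM
  have hpair : ∃ y₀ ∈ 𝒴, ∃ y₁ ∈ 𝒴, y₀ < y₁ ∨ 𝒴 ⊆ {y₀} := by
    by_cases hs : 𝒴.Subsingleton
    · obtain ⟨y, hy⟩ := h𝒴
      exact ⟨y, hy, y, hy, Or.inr fun z hz => hs hz hy⟩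
    · rw [Set.not_subsingleton_iff] at hs
      obtain ⟨u, hu, v, hv, huv⟩ := hs
      rcases huv.lt_or_gt with h | h
      · exact ⟨u, hu, v, hv, Or.inl h⟩
      · exact ⟨v, hv, u, hu, Or.inl h⟩
  obtain ⟨y₀, hy₀, y₁, hy₁, hcase⟩ := hpair
  obtain ⟨B, hMB, h𝒴B, haB⟩ := hℓ.exists_bound (y₀ := y₀) ha₀
  obtain ⟨L, hL⟩ := (hℓ.locallyLipschitz.locallyLipschitzOn
    (s := Set.Icc (-(B : ℝ)) B ×ˢ Set.Icc (-(B : ℝ)) B)).exists_lipschitzOnWith_of_compact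
    (isCompact_Icc.prod isCompact_Icc)
  -- To the left of `y₀` the label `y₁` is strictly costlier than `y₀`; compactness makes the
  -- difference uniform.
  have hgap : ∃ c : ℝ, 0 < c ∧ (y₀ < y₁ → ∀ a : ℝ, |a| ≤ B → a ≤ y₀ → c ≤ ℓ a y₁ - ℓ a y₀) := by
    by_cases hlt : y₀ < y₁
    · have hcont : ContinuousOn (fun a => ℓ a y₁ - ℓ a y₀) (Set.Icc (-(B : ℝ)) y₀) :=
        ((hℓ.continuous.comp (by fun_prop : Continuous fun a : ℝ => (a, y₁))).sub
          (hℓ.continuous.comp (by fun_prop : Continuous fun a : ℝ => (a, y₀)))).continuousOn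
      obtain ⟨x, hx, hmin⟩ := isCompact_Icc.exists_isMinOn
        ⟨y₀, (abs_le.1 (h𝒴B y₀ hy₀)).1, le_rfl⟩ hcont
      refine ⟨_, sub_pos.2 (hℓ.lt_of_under x y₀ x y₁ le_rfl hx.2 hlt.le
        fun he => hlt.ne (Prod.ext_iff.1 he).2), fun _ a ha ha' => hmin ⟨(abs_le.1 ha).1, ha'⟩⟩
    · exact ⟨1, one_pos, fun h => absurd h hlt⟩
  obtain ⟨c, hc, hgap⟩ := hgap
  -- The factor `m₀` refines the grid so that its mesh `r` satisfies `r ≤ 1 / m`, `L * r ≤ 1 / m`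
  -- and `2 * r < c`.
  obtain ⟨m₀, hm₀⟩ := exists_nat_gt (max 1 (max (L : ℝ) (2 / c)))
  simp only [max_lt_iff] at hm₀
  obtain ⟨hm1, hmL, hmc⟩ := hm₀
  refine ⟨y₀, hy₀, y₁, hy₁, (6 * B + 3) * m₀, fun m hm => ?_⟩
  have hm₀' : 1 ≤ m₀ := by exact_mod_cast hm1.le
  have hq : 1 ≤ m₀ * m := Nat.mul_pos hm₀' hm
  obtain ⟨G, hGc, hG⟩ := exists_grid B (m₀ * m) hq
  have hm' : (1 : ℝ) ≤ m := by exact_mod_cast hm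
  have hmpos : (0 : ℝ) < m := by linarith
  have hm₀pos : (0 : ℝ) < m₀ := by linarith
  set r : ℝ := 1 / ((m₀ * m : ℕ) : ℝ) with hr
  have hr1 : r ≤ 1 / m := by
    rw [hr]
    push_cast
    exact one_div_le_one_div_of_le hmpos (by nlinarith)
  have hrL : L * r ≤ 1 / m := by
    rw [hr]
    push_cast
    rw [mul_one_div, div_le_div_iff₀ (by positivity) hmpos]
    nlinarith
  have hrc : 2 * r < c := by
    rw [div_lt_iff₀ hc] at hmc
    rw [hr, mul_one_div, div_lt_iff₀ (by positivity)]
    push_cast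
    nlinarith [mul_pos hc hm₀pos]
  refine ⟨G ∪ (G.image (fun s => ℓ s y₀) ∪ G.image (fun s => ℓ s y₁)), ?_, ?_⟩
  · have h1 := Finset.card_union_le G (G.image (fun s => ℓ s y₀) ∪ G.image (fun s => ℓ s y₁))
    have h2 := Finset.card_union_le (G.image (fun s => ℓ s y₀)) (G.image (fun s => ℓ s y₁))
    have h3 := Finset.card_image_le (s := G) (f := fun s => ℓ s y₀)
    have h4 := Finset.card_image_le (s := G) (f := fun s => ℓ s y₁)
    nlinarith
  · have symm : ∀ a b : ℝ, a ≤ b → (∀ y ∈ 𝒴, ℓ a y ≤ M) → (∀ y ∈ 𝒴, ℓ b y ≤ M) →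
        (∀ t ∈ G ∪ (G.image (fun s => ℓ s y₀) ∪ G.image (fun s => ℓ s y₁)),
          (t < ℓ a y₀ ↔ t < ℓ b y₀)) →
        (∀ t ∈ G ∪ (G.image (fun s => ℓ s y₀) ∪ G.image (fun s => ℓ s y₁)),
          (t < ℓ a y₁ ↔ t < ℓ b y₁)) →
        ∀ y ∈ 𝒴, |ℓ a y - ℓ b y| ≤ 1 / m := by
      intro a b hab ha hb hp0 hp1 y hy
      have haB' := haB a (ha y₀ hy₀)
      have hbB' := haB b (hb y₀ hy₀)
      have habs : ∀ x y, ℓ x y ≤ M → |ℓ x y| ≤ B := fun x y h => by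
        rw [abs_of_nonneg (hℓ.nonneg x y)]
        exact h.trans hMB
      have hd0 : |ℓ a y₀ - ℓ b y₀| ≤ r := abs_sub_le_of_grid (G := G) hG
        (habs _ _ (ha y₀ hy₀)) (habs _ _ (hb y₀ hy₀))
        fun s hs => hp0 s (Finset.mem_union_left _ hs)
      have hd1 : |ℓ a y₁ - ℓ b y₁| ≤ r := abs_sub_le_of_grid (G := G) hG
        (habs _ _ (ha y₁ hy₁)) (habs _ _ (hb y₁ hy₁))
        fun s hs => hp1 s (Finset.mem_union_left _ hs)
      rcases hcase with hlt | hsub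
      · have hclose : b - a ≤ r → |ℓ a y - ℓ b y| ≤ 1 / m := by
          intro h
          have hyB := abs_le.1 (h𝒴B y hy)
          have := hL.dist_le_mul (a, y) ⟨abs_le.1 haB', hyB⟩ (b, y) ⟨abs_le.1 hbB', hyB⟩
          simp only [Real.dist_eq, Prod.dist_eq, sub_self, abs_zero] at this
          rw [max_eq_left (abs_nonneg _), abs_sub_comm a b, abs_of_nonneg (sub_nonneg.2 hab)] at this
          exact this.trans ((mul_le_mul_of_nonneg_left h L.2).trans hrL)
        by_cases h0 : y₀ ≤ a ∨ b ≤ y₀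
        · exact hclose (hℓ.sub_le_of_grid (G := G) (hG a b (abs_le.1 haB').1 (abs_le.1 hbB').2)
            (fun s hs => hp0 _ (Finset.mem_union_right _ (Finset.mem_union_left _
              (Finset.mem_image_of_mem _ hs)))) h0)
        by_cases h1 : y₁ ≤ a ∨ b ≤ y₁
        · exact hclose (hℓ.sub_le_of_grid (G := G) (hG a b (abs_le.1 haB').1 (abs_le.1 hbB').2)
            (fun s hs => hp1 _ (Finset.mem_union_right _ (Finset.mem_union_right _
              (Finset.mem_image_of_mem _ hs)))) h1)
        -- What remains is `a < y₀ < y₁ < b`. At `a` the loss at `y₁` exceeds that at `y₀` by at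
        -- least `c`, at `b` it is smaller, yet both losses agree at `a` and `b` up to `r`; this
        -- contradicts `2 * r < c`.
        push Not at h0 h1
        have e1 := hgap hlt a haB' h0.1.le
        have e2 : ℓ b y₁ < ℓ b y₀ := hℓ.lt_of_over b y₁ b y₀ hlt.le h1.2.le le_rfl
          fun he => hlt.ne' (Prod.ext_iff.1 he).2
        have e3 := (abs_le.1 hd0).1
        have e4 := (abs_le.1 hd1).2
        linarith
      -- With a single label the prediction need not be located: its loss at `y₀` is all that
      -- counts.
      · have : y = y₀ := hsub hy
        rw [this]
        exact hd0.trans hr1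
    intro a b ha hb hp0 hp1 y hy
    rcases le_total a b with h | h
    · exact symm a b h ha hb hp0 hp1 y hy
    · rw [abs_sub_comm]
      exact symm b a h hb ha (fun t ht => (hp0 t ht).symm) (fun t ht => (hp1 t ht).symm) y hy

/-! ### Sauer's lemma and finite covers -/

theorem sum_choose_le (N d : ℕ) : ∑ k ∈ Finset.Iic d, N.choose k ≤ (d + 1) * (N + 1) ^ d := by
  calc ∑ k ∈ Finset.Iic d, N.choose k ≤ ∑ _k ∈ Finset.Iic d, (N + 1) ^ d := by
        refine Finset.sum_le_sum fun k hk => ?_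
        calc N.choose k ≤ N ^ k := Nat.choose_le_pow N k
          _ ≤ (N + 1) ^ k := Nat.pow_le_pow_left (Nat.le_succ N) k
          _ ≤ (N + 1) ^ d := Nat.pow_le_pow_right (Nat.succ_pos N) (Finset.mem_Iic.1 hk)
    _ = (d + 1) * (N + 1) ^ d := by simp

/-- Sauer's lemma for the subgraphs of a class of bounded pseudo-dimension. -/
theorem card_subgraph_patterns_le {𝒳 ι κ : Type*} [Fintype ι] [Fintype κ] [DecidableEq ι]
    [DecidableEq κ] {H : Set (𝒳 → ℝ)} {d : ℕ} (hd : ∀ s, PseudoShatters H s → s.card ≤ d)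
    (x : ι → 𝒳) (t : κ → ℝ) (𝒜 : Finset (Finset (ι × κ)))
    (h𝒜 : ∀ A ∈ 𝒜, ∃ h ∈ H, ∀ p : ι × κ, p ∈ A ↔ t p.2 < h (x p.1)) :
    𝒜.card ≤ (d + 1) * (Fintype.card ι * Fintype.card κ + 1) ^ d := by
  classical
  have hvc : 𝒜.vcDim ≤ d := by
    refine Finset.sup_le fun s hs => ?_
    rw [Finset.mem_shatterer] at hs
    have hcut : ∀ b ⊆ s, ∃ h ∈ H, ∀ p ∈ s, (t p.2 < h (x p.1) ↔ p ∈ b) := by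
      intro b hb
      obtain ⟨A, hA, hAb⟩ := hs hb
      obtain ⟨h, hh, hp⟩ := h𝒜 A hA
      refine ⟨h, hh, fun p hps => ?_⟩
      rw [← hp p, ← hAb, Finset.mem_inter]
      exact ⟨fun h => ⟨hps, h⟩, fun h => h.2⟩
    -- Over one point, exceeding the higher threshold entails exceeding the lower one, so the higher
    -- pair cannot be cut out alone. A shattered set of pairs therefore has at most one threshold
    -- per point, and projects injectively to a pseudo-shattered set.
    have hinj' : ∀ p ∈ s, ∀ q ∈ s, x p.1 = x q.1 → t p.2 ≤ t q.2 → p = q := by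
      intro p hp q hq hpq htq
      obtain ⟨h, -, hh⟩ := hcut {q} (Finset.singleton_subset_iff.2 hq)
      have h1 := (hh q hq).2 (Finset.mem_singleton_self q)
      have h2 := (hh p hp).1 (by rw [hpq]; exact htq.trans_lt h1)
      exact Finset.mem_singleton.1 h2
    have hinj : Set.InjOn (fun p : ι × κ => x p.1) s := by
      intro p hp q hq hpq
      rcases le_total (t p.2) (t q.2) with h | h
      · exact hinj' p hp q hq hpq h
      · exact (hinj' q hq p hp hpq.symm h).symm
    rw [← Finset.card_image_of_injOn hinj]
    refine hd _ ?_
    refine ⟨fun u => if hu : ∃ p ∈ s, x p.1 = u then t hu.choose.2 else 0, fun b _ => ?_⟩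
    obtain ⟨h, hh, hp⟩ := hcut (s.filter fun p => x p.1 ∈ b) (Finset.filter_subset _ _)
    refine ⟨h, hh, fun u hu => ?_⟩
    obtain ⟨p, hps, rfl⟩ := Finset.mem_image.1 hu
    have hex : ∃ q ∈ s, x q.1 = x p.1 := ⟨p, hps, rfl⟩
    have hq : hex.choose = p := hinj hex.choose_spec.1 hps hex.choose_spec.2
    simp only
    rw [dif_pos hex, hq, hp p hps]
    simp [hps]
  calc 𝒜.card ≤ 𝒜.shatterer.card := Finset.card_le_card_shatterer 𝒜
    _ ≤ ∑ k ∈ Finset.Iic 𝒜.vcDim, (Fintype.card (ι × κ)).choose k :=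
        Finset.card_shatterer_le_sum_vcDim
    _ ≤ ∑ k ∈ Finset.Iic d, (Fintype.card (ι × κ)).choose k :=
        Finset.sum_le_sum_of_subset (Finset.Iic_subset_Iic.2 hvc)
    _ ≤ _ := by rw [Fintype.card_prod]; exact sum_choose_le _ _

theorem exists_card_le_of_pseudoDim_lt_top {𝒳 : Type*} {H : Set (𝒳 → ℝ)} (h : pseudoDim H < ⊤) :
    ∃ d : ℕ, ∀ s, PseudoShatters H s → s.card ≤ d := by
  lift pseudoDim H to ℕ using h.ne with d hd
  refine ⟨d, fun s hs => ?_⟩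
  have : (s.card : ℕ∞) ≤ pseudoDim H :=
    le_iSup₂ (f := fun (s : Finset 𝒳) (_ : PseudoShatters H s) => (s.card : ℕ∞)) s hs
  rw [← hd] at this
  exact_mod_cast this

/-- If the loss class has finite pseudo-dimension, then finitely many models, polynomially many in
the number of points and the resolution `m`, represent all models on a given finite sample. -/
theorem IsRegressionLoss.exists_cover {𝒳 : Type*} {ℓ : ℝ → ℝ → ℝ} (hℓ : IsRegressionLoss ℓ)
    {𝒴 : Set ℝ} (h𝒴 : 𝒴.Nonempty) {F : Set (𝒳 → ℝ)} (hdim : pseudoDim (lossClass ℓ F 𝒴) < ⊤)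
    {M : ℝ} (hM : ∀ f ∈ F, ∀ x : 𝒳, ∀ y ∈ 𝒴, ℓ (f x) y ≤ M) [Nonempty 𝒳] (hF : F.Nonempty) :
    ∃ A d : ℕ, ∀ m : ℕ, 1 ≤ m → ∀ (ι : Type) [Fintype ι] (x : ι → 𝒳),
      ∃ F₀ : Finset (𝒳 → ℝ), ↑F₀ ⊆ F ∧ F₀.card ≤ A * (A * (Fintype.card ι * m) + 1) ^ d ∧
        ∀ f ∈ F, ∃ g ∈ F₀, ∀ i, ∀ y ∈ 𝒴, |ℓ (f (x i)) y - ℓ (g (x i)) y| ≤ 1 / m := by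
  classical
  obtain ⟨f₀, hf₀⟩ := hF
  obtain ⟨y₀, hy₀, y₁, hy₁, A, hA⟩ := hℓ.exists_thresholds h𝒴
    ⟨f₀ (Classical.arbitrary 𝒳), fun y hy => hM f₀ hf₀ _ y hy⟩
  obtain ⟨d, hd⟩ := exists_card_le_of_pseudoDim_lt_top hdim
  refine ⟨max A ((d + 1) ^ 2), 2 * d, fun m hm ι _ x => ?_⟩
  obtain ⟨T, hTc, hT⟩ := hA m hm
  let pat : ℝ → (𝒳 → ℝ) → Finset (ι × T) := fun y f =>
    Finset.univ.filter fun p => (p.2 : ℝ) < ℓ (f (x p.1)) y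
  let 𝒜 : ℝ → Finset (Finset (ι × T)) := fun y =>
    Finset.univ.filter fun A => ∃ f ∈ F, pat y f = A
  have h𝒜 : ∀ y ∈ 𝒴, (𝒜 y).card ≤ (d + 1) * (Fintype.card ι * Fintype.card T + 1) ^ d := by
    intro y hy
    refine card_subgraph_patterns_le hd x (fun k : T => (k : ℝ)) (𝒜 y) fun A' hA' => ?_
    obtain ⟨f, hf, rfl⟩ := (Finset.mem_filter.1 hA').2
    exact ⟨_, ⟨f, hf, y, hy, rfl⟩, fun p => by simp [pat]⟩
  -- The two patterns must come from the same model, so that each pair has a representative in `F`.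
  let Q := (𝒜 y₀ ×ˢ 𝒜 y₁).filter fun p => ∃ f ∈ F, (pat y₀ f, pat y₁ f) = p
  have hQ : ∀ p ∈ Q, ∃ f ∈ F, (pat y₀ f, pat y₁ f) = p := fun p hp => (Finset.mem_filter.1 hp).2
  choose! rep hrepF hrep using hQ
  refine ⟨Q.image rep, ?_, ?_, fun f hf => ?_⟩
  · intro g hg
    obtain ⟨p, hp, rfl⟩ := Finset.mem_image.1 hg
    exact hrepF p hp
  · have hT' : Fintype.card T ≤ A * m := by simpa using hTc
    have hbase : Fintype.card ι * Fintype.card T + 1 ≤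
        max A ((d + 1) ^ 2) * (Fintype.card ι * m) + 1 := by
      have h1 : Fintype.card ι * Fintype.card T ≤ Fintype.card ι * (A * m) :=
        Nat.mul_le_mul_left _ hT'
      have h2 : A * (Fintype.card ι * m) ≤ max A ((d + 1) ^ 2) * (Fintype.card ι * m) :=
        Nat.mul_le_mul_right _ (le_max_left _ _)
      have h3 : Fintype.card ι * (A * m) = A * (Fintype.card ι * m) := by ring
      omega
    calc (Q.image rep).card ≤ Q.card := Finset.card_image_le
      _ ≤ (𝒜 y₀ ×ˢ 𝒜 y₁).card := Finset.card_filter_le _ _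
      _ = (𝒜 y₀).card * (𝒜 y₁).card := Finset.card_product _ _
      _ ≤ ((d + 1) * (Fintype.card ι * Fintype.card T + 1) ^ d) *
          ((d + 1) * (Fintype.card ι * Fintype.card T + 1) ^ d) :=
          Nat.mul_le_mul (h𝒜 y₀ hy₀) (h𝒜 y₁ hy₁)
      _ = (d + 1) ^ 2 * (Fintype.card ι * Fintype.card T + 1) ^ (2 * d) := by ring
      _ ≤ _ := Nat.mul_le_mul (le_max_right _ _) (Nat.pow_le_pow_left hbase _)
  · have hmem : (pat y₀ f, pat y₁ f) ∈ Q :=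
      Finset.mem_filter.2 ⟨Finset.mem_product.2
        ⟨Finset.mem_filter.2 ⟨Finset.mem_univ _, f, hf, rfl⟩,
          Finset.mem_filter.2 ⟨Finset.mem_univ _, f, hf, rfl⟩⟩, f, hf, rfl⟩
    refine ⟨_, Finset.mem_image_of_mem _ hmem, fun i y hy => ?_⟩
    have hr := hrep _ hmem
    have hrF := hrepF _ hmem
    set g := rep (pat y₀ f, pat y₁ f)
    obtain ⟨e0, e1⟩ := Prod.ext_iff.1 hr
    refine hT _ _ (hM f hf _) (hM g hrF _) (fun t ht => ?_) (fun t ht => ?_) y hy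
    · have := Finset.ext_iff.1 e0 (i, ⟨t, ht⟩)
      simpa [pat] using this.symm
    · have := Finset.ext_iff.1 e1 (i, ⟨t, ht⟩)
      simpa [pat] using this.symm

/-! ### Symmetrization by a ghost sample -/

/-- The sample of pairs `w` with the `i`-th pair swapped whenever `σ i` is true. -/
def swapPairs {Z : Type*} {n : ℕ} (σ : Fin n → Bool) (w : Fin n → Z × Z) : Fin n → Z × Z :=
  fun i => if σ i then (w i).swap else w i

theorem measurePreserving_swapPairs {Z : Type*} [MeasurableSpace Z] (μ : Measure Z)
    [IsProbabilityMeasure μ] {n : ℕ} (σ : Fin n → Bool) :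
    MeasurePreserving (swapPairs σ) (Measure.pi fun _ : Fin n => μ.prod μ)
      (Measure.pi fun _ : Fin n => μ.prod μ) := by
  have h : ∀ i, MeasurePreserving (fun p : Z × Z => if σ i then p.swap else p) (μ.prod μ)
      (μ.prod μ) := fun i => by
    cases σ i
    · simp only [Bool.false_eq_true, if_false]
      exact MeasurePreserving.id _
    · simpa using Measure.measurePreserving_swap (μ := μ) (ν := μ)
  exact measurePreserving_pi (fun _ : Fin n => μ.prod μ) (fun _ => μ.prod μ) h

theorem measurePreserving_unzip_swapPairs {Z : Type*} [MeasurableSpace Z] (μ : Measure Z)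
    [IsProbabilityMeasure μ] {n : ℕ} (σ : Fin n → Bool) :
    MeasurePreserving
      (fun w : Fin n → Z × Z => ((fun i => (swapPairs σ w i).1), fun i => (swapPairs σ w i).2))
      (Measure.pi fun _ : Fin n => μ.prod μ)
      ((Measure.pi fun _ : Fin n => μ).prod (Measure.pi fun _ : Fin n => μ)) :=
  (measurePreserving_arrowProdEquivProdArrow Z Z (Fin n) (fun _ => μ) fun _ => μ).comp
    (measurePreserving_swapPairs μ σ)

/-- There are finitely many swaps and each preserves the law, so the estimator may be retrained on
every swapped first half outside one null set. -/
theorem ae_forall_swapPairs {Z : Type*} [MeasurableSpace Z] (μ : Measure Z)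
    [IsProbabilityMeasure μ] {n : ℕ} {p : (Fin n → Z) → Prop}
    (hp : ∀ᵐ z ∂(Measure.pi fun _ : Fin n => μ), p z) :
    ∀ᵐ w ∂(Measure.pi fun _ : Fin n => μ.prod μ), ∀ σ, p fun i => (swapPairs σ w i).1 := by
  rw [ae_all_iff]
  intro σ
  exact (Measure.quasiMeasurePreserving_fst.comp
    (measurePreserving_unzip_swapPairs μ σ).quasiMeasurePreserving).ae hp

theorem ae_pi_forall {Z : Type*} [MeasurableSpace Z] (μ : Measure Z) [IsProbabilityMeasure μ]
    {n : ℕ} {p : Z → Prop} (hp : ∀ᵐ u ∂μ, p u) :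
    ∀ᵐ z ∂(Measure.pi fun _ : Fin n => μ), ∀ i, p (z i) := by
  rw [ae_all_iff]
  intro i
  exact (Measure.quasiMeasurePreserving_eval (fun _ : Fin n => μ) i).ae hp

/-- Symmetrization: an integral over two independent samples is bounded by a bound on the averages
over the swaps of the two samples. -/
theorem lintegral_prod_pi_le_of_swap {Z : Type*} [MeasurableSpace Z] (μ : Measure Z)
    [IsProbabilityMeasure μ] {n : ℕ} {Φ : (Fin n → Z) × (Fin n → Z) → ENNReal} (hΦ : Measurable Φ)
    {K : ENNReal}
    (h : ∀ᵐ w ∂(Measure.pi fun _ : Fin n => μ.prod μ),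
      ∑ σ : Fin n → Bool, Φ ((fun i => (swapPairs σ w i).1), fun i => (swapPairs σ w i).2) ≤
        2 ^ n * K) :
    ∫⁻ p, Φ p ∂((Measure.pi fun _ : Fin n => μ).prod (Measure.pi fun _ : Fin n => μ)) ≤ K := by
  have h2 : (2 : ENNReal) ^ n * ∫⁻ p, Φ p ∂((Measure.pi fun _ : Fin n => μ).prod
      (Measure.pi fun _ : Fin n => μ)) ≤ 2 ^ n * K := by
    calc (2 : ENNReal) ^ n * ∫⁻ p, Φ p ∂((Measure.pi fun _ : Fin n => μ).prod
          (Measure.pi fun _ : Fin n => μ))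
        = ∑ σ : Fin n → Bool, ∫⁻ w, Φ ((fun i => (swapPairs σ w i).1),
            fun i => (swapPairs σ w i).2) ∂(Measure.pi fun _ : Fin n => μ.prod μ) := by
          rw [Finset.sum_congr rfl fun σ _ =>
            (measurePreserving_unzip_swapPairs μ σ).lintegral_comp hΦ]
          simp
      _ = ∫⁻ w, ∑ σ : Fin n → Bool, Φ ((fun i => (swapPairs σ w i).1),
            fun i => (swapPairs σ w i).2) ∂(Measure.pi fun _ : Fin n => μ.prod μ) :=
          (lintegral_finsetSum _ fun σ _ =>
            hΦ.comp (measurePreserving_unzip_swapPairs μ σ).measurable).symm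
      _ ≤ ∫⁻ _w, 2 ^ n * K ∂(Measure.pi fun _ : Fin n => μ.prod μ) := lintegral_mono_ae h
      _ = 2 ^ n * K := by simp
  exact (ENNReal.mul_le_mul_iff_right (by simp) (by finiteness)).1 h2

/-! ### Exponential moments -/

/-- The weights are deliberately unequal. With `s = a / M`, `t = b / M`, chords of the exponential
bound the terms by `(1 + 2s/5)(1 - 3t/5)` and its mirror image, whose sum is `2 - (s + t)/5 -
12st/25`. The negative linear part removes any variance term. -/
theorem exp_swap_add_le_two {M a b : ℝ} (hM : 0 < M) (ha : 0 ≤ a) (haM : a ≤ M) (hb : 0 ≤ b)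
    (hbM : b ≤ M) :
    Real.exp (a / (3 * M) - b / M) + Real.exp (b / (3 * M) - a / M) ≤ 2 := by
  have hexp3 : Real.exp (1 / 3) ≤ 7 / 5 := by
    have h : Real.exp (1 / 3) ^ 3 ≤ (7 / 5) ^ 3 := by
      rw [← Real.exp_nat_mul]
      have := Real.exp_one_lt_d9
      norm_num at this ⊢
      linarith
    exact le_of_pow_le_pow_left₀ (by norm_num) (by norm_num) h
  have hexp1 : Real.exp (-1) ≤ 2 / 5 := by
    rw [Real.exp_neg, inv_le_comm₀ (Real.exp_pos _) (by norm_num)]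
    have := Real.exp_one_gt_d9
    norm_num at this ⊢
    linarith
  have chord : ∀ t c : ℝ, 0 ≤ t → t ≤ 1 → Real.exp (t * c) ≤ (1 - t) + t * Real.exp c := by
    intro t c h0 h1
    have := convexOn_exp.2 (Set.mem_univ (0 : ℝ)) (Set.mem_univ c) (sub_nonneg.2 h1) h0 (by ring)
    simpa using this
  have key : ∀ s t : ℝ, 0 ≤ s → s ≤ 1 → 0 ≤ t → t ≤ 1 →
      Real.exp (s / 3 - t) ≤ (1 + 2 / 5 * s) * (1 - 3 / 5 * t) := by
    intro s t hs hs1 ht ht1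
    have e1 := chord s (1 / 3) hs hs1
    have e2 := chord t (-1) ht ht1
    have : s / 3 - t = s * (1 / 3) + t * (-1) := by ring
    rw [this, Real.exp_add]
    refine mul_le_mul ?_ ?_ (Real.exp_pos _).le (by positivity)
    · nlinarith
    · nlinarith
  have hs0 : 0 ≤ a / M := by positivity
  have hs1 : a / M ≤ 1 := (div_le_one hM).2 haM
  have ht0 : 0 ≤ b / M := by positivity
  have ht1 : b / M ≤ 1 := (div_le_one hM).2 hbM
  have e1 := key _ _ hs0 hs1 ht0 ht1
  have e2 := key _ _ ht0 ht1 hs0 hs1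
  have r1 : a / (3 * M) = a / M / 3 := by rw [div_div, mul_comm]
  have r2 : b / (3 * M) = b / M / 3 := by rw [div_div, mul_comm]
  rw [r1, r2]
  nlinarith [mul_nonneg hs0 ht0]

/-- The swaps act on separate pairs, so the sum over all swaps factors into a product over pairs. -/
theorem sum_swap_exp_le {Z : Type*} {n : ℕ} {M : ℝ} (hM : 0 < M) (w : Fin n → Z × Z) {g : Z → ℝ}
    (h1 : ∀ i, 0 ≤ g (w i).1 ∧ g (w i).1 ≤ M) (h2 : ∀ i, 0 ≤ g (w i).2 ∧ g (w i).2 ≤ M) :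
    ∑ σ : Fin n → Bool, Real.exp (∑ i, (g (swapPairs σ w i).2 / (3 * M) -
      g (swapPairs σ w i).1 / M)) ≤ 2 ^ n := by
  let ψ : Fin n → Bool → ℝ := fun i b =>
    Real.exp (g (if b then (w i).swap else w i).2 / (3 * M) -
      g (if b then (w i).swap else w i).1 / M)
  calc ∑ σ : Fin n → Bool, Real.exp (∑ i, (g (swapPairs σ w i).2 / (3 * M) -
        g (swapPairs σ w i).1 / M))
      = ∑ σ : Fin n → Bool, ∏ i, ψ i (σ i) := by simp_rw [Real.exp_sum]; rfl
    _ = ∏ i, ∑ b, ψ i b := by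
        rw [Finset.prod_univ_sum, Fintype.piFinset_univ]
    _ ≤ ∏ _i : Fin n, (2 : ℝ) := by
        refine Finset.prod_le_prod (fun i _ => Finset.sum_nonneg fun b _ => (Real.exp_pos _).le)
          fun i _ => ?_
        have := exp_swap_add_le_two hM (h1 i).1 (h1 i).2 (h2 i).1 (h2 i).2
        simpa [ψ] using this
    _ = 2 ^ n := by simp

/-- Swap averages of exponential deviations, uniformly over functions that are covered at scale
`1 / n` on the double sample by a finite class. -/
theorem sum_swap_exp_le_of_cover {Z : Type*} {n : ℕ} (hn : 1 ≤ n) {M : ℝ} (hM : 1 ≤ M)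
    (w : Fin n → Z × Z) (𝒢 : Finset (Z → ℝ))
    (h1 : ∀ g ∈ 𝒢, ∀ i, 0 ≤ g (w i).1 ∧ g (w i).1 ≤ M)
    (h2 : ∀ g ∈ 𝒢, ∀ i, 0 ≤ g (w i).2 ∧ g (w i).2 ≤ M) (φ : (Fin n → Bool) → Z → ℝ)
    (hφ : ∀ σ, ∃ g ∈ 𝒢, ∀ i, |φ σ (w i).1 - g (w i).1| ≤ 1 / n ∧
      |φ σ (w i).2 - g (w i).2| ≤ 1 / n) :
    ∑ σ : Fin n → Bool, Real.exp (∑ i, (φ σ (swapPairs σ w i).2 / (3 * M) -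
      φ σ (swapPairs σ w i).1 / M)) ≤ 2 ^ n * (Real.exp 2 * 𝒢.card) := by
  have hM0 : 0 < M := by linarith
  have hn0 : (0 : ℝ) < n := by exact_mod_cast hn
  have hterm : ∀ σ, Real.exp (∑ i, (φ σ (swapPairs σ w i).2 / (3 * M) -
      φ σ (swapPairs σ w i).1 / M)) ≤ Real.exp 2 * ∑ g ∈ 𝒢,
        Real.exp (∑ i, (g (swapPairs σ w i).2 / (3 * M) - g (swapPairs σ w i).1 / M)) := by
    intro σ
    obtain ⟨g, hg, hclose⟩ := hφ σ
    have hs : ∀ i, |φ σ (swapPairs σ w i).1 - g (swapPairs σ w i).1| ≤ 1 / n ∧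
        |φ σ (swapPairs σ w i).2 - g (swapPairs σ w i).2| ≤ 1 / n := by
      intro i
      unfold swapPairs
      cases σ i
      · simpa using hclose i
      · simpa using (hclose i).symm
    -- Since `M ≥ 1`, replacing `φ σ` by `g` costs at most `2 / n` in each of the `n` summands,
    -- hence the factor `exp 2`.
    have hsum : ∑ i, (φ σ (swapPairs σ w i).2 / (3 * M) - φ σ (swapPairs σ w i).1 / M) ≤
        2 + ∑ i, (g (swapPairs σ w i).2 / (3 * M) - g (swapPairs σ w i).1 / M) := by
      have : (2 : ℝ) = ∑ _i : Fin n, 2 / (n : ℝ) := by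
        rw [Finset.sum_const, Finset.card_univ, Fintype.card_fin, nsmul_eq_mul]
        field_simp
      rw [this, ← Finset.sum_add_distrib]
      refine Finset.sum_le_sum fun i _ => ?_
      have e1 := (abs_le.1 (hs i).1).1
      have e2 := (abs_le.1 (hs i).2).2
      have hn' : (0 : ℝ) ≤ 1 / n := by positivity
      have d1 : (φ σ (swapPairs σ w i).2 - g (swapPairs σ w i).2) / (3 * M) ≤ 1 / n := by
        rw [div_le_iff₀ (by linarith)]
        nlinarith
      have d2 : (g (swapPairs σ w i).1 - φ σ (swapPairs σ w i).1) / M ≤ 1 / n := by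
        rw [div_le_iff₀ hM0]
        nlinarith
      rw [sub_div] at d1 d2
      have : (2 : ℝ) / n = 1 / n + 1 / n := by ring
      linarith
    calc Real.exp (∑ i, (φ σ (swapPairs σ w i).2 / (3 * M) - φ σ (swapPairs σ w i).1 / M))
        ≤ Real.exp 2 * Real.exp (∑ i, (g (swapPairs σ w i).2 / (3 * M) -
            g (swapPairs σ w i).1 / M)) := by
          rw [← Real.exp_add]
          exact Real.exp_le_exp.2 hsum
      _ ≤ _ := by
          refine mul_le_mul_of_nonneg_left ?_ (Real.exp_pos _).le
          exact Finset.single_le_sum (f := fun g : Z → ℝ => Real.exp (∑ i,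
            (g (swapPairs σ w i).2 / (3 * M) - g (swapPairs σ w i).1 / M)))
            (fun _ _ => (Real.exp_pos _).le) hg
  calc _ ≤ ∑ σ : Fin n → Bool, Real.exp 2 * ∑ g ∈ 𝒢,
        Real.exp (∑ i, (g (swapPairs σ w i).2 / (3 * M) - g (swapPairs σ w i).1 / M)) :=
        Finset.sum_le_sum fun σ _ => hterm σ
    _ = Real.exp 2 * ∑ g ∈ 𝒢, ∑ σ : Fin n → Bool,
        Real.exp (∑ i, (g (swapPairs σ w i).2 / (3 * M) - g (swapPairs σ w i).1 / M)) := by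
        rw [← Finset.mul_sum, Finset.sum_comm]
    _ ≤ Real.exp 2 * ∑ _g ∈ 𝒢, (2 : ℝ) ^ n := by
        refine mul_le_mul_of_nonneg_left (Finset.sum_le_sum fun g hg => ?_) (Real.exp_pos _).le
        exact sum_swap_exp_le hM0 w (h1 g hg) (h2 g hg)
    _ = 2 ^ n * (Real.exp 2 * 𝒢.card) := by
        rw [Finset.sum_const, nsmul_eq_mul]
        ring

/-- Jensen's inequality for the exponential: it replaces the risk by an average over a ghost sample.
-/
theorem ofReal_exp_integral_le_lintegral_pi {Z : Type*} [MeasurableSpace Z] (μ : Measure Z)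
    [IsProbabilityMeasure μ] (n : ℕ) {g : Z → ℝ} (hg : Measurable g) {B : ℝ}
    (hB : ∀ᵐ u ∂μ, |g u| ≤ B) :
    ENNReal.ofReal (Real.exp (n * ∫ u, g u ∂μ)) ≤
      ∫⁻ z, ENNReal.ofReal (Real.exp (∑ i, g (z i))) ∂(Measure.pi fun _ : Fin n => μ) := by
  have hgi : Integrable g μ := Integrable.of_bound hg.aestronglyMeasurable B hB
  have hev : ∀ i : Fin n, MeasurePreserving (Function.eval i) (Measure.pi fun _ : Fin n => μ) μ :=
    fun i => measurePreserving_eval (fun _ : Fin n => μ) i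
  have hgi' : ∀ i : Fin n, Integrable (fun z : Fin n → Z => g (z i))
      (Measure.pi fun _ : Fin n => μ) := fun i => (hev i).integrable_comp_of_integrable hgi
  have hmeas : Measurable fun z : Fin n → Z => ∑ i, g (z i) := by fun_prop
  have hint : ∫ z, ∑ i, g (z i) ∂(Measure.pi fun _ : Fin n => μ) = n * ∫ u, g u ∂μ := by
    rw [integral_finsetSum _ fun i _ => hgi' i]
    have : ∀ i : Fin n, ∫ z, g (z i) ∂(Measure.pi fun _ : Fin n => μ) = ∫ u, g u ∂μ := by
      intro i
      have := integral_map (μ := Measure.pi fun _ : Fin n => μ) (φ := Function.eval i)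
        (measurable_pi_apply i).aemeasurable hg.aestronglyMeasurable
      rw [(hev i).map_eq] at this
      exact this.symm
    simp [this]
  have hexpi : Integrable (fun z : Fin n → Z => Real.exp (∑ i, g (z i)))
      (Measure.pi fun _ : Fin n => μ) := by
    refine Integrable.of_bound hmeas.exp.aestronglyMeasurable (Real.exp (n * B)) ?_
    filter_upwards [ae_pi_forall μ hB] with z hz
    rw [Real.norm_eq_abs, abs_of_pos (Real.exp_pos _), Real.exp_le_exp]
    calc ∑ i, g (z i) ≤ ∑ _i : Fin n, B := Finset.sum_le_sum fun i _ => (abs_le.1 (hz i)).2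
      _ = n * B := by simp
  rw [← hint, ← ofReal_integral_eq_lintegral_ofReal hexpi
    (Filter.Eventually.of_forall fun z => (Real.exp_pos _).le)]
  refine ENNReal.ofReal_le_ofReal ?_
  exact convexOn_exp.map_integral_le Real.continuous_exp.continuousOn isClosed_univ
    (Filter.Eventually.of_forall fun _ => Set.mem_univ _) (integrable_finsetSum _ fun i _ => hgi' i)
    hexpi

/-- An exponential moment of the risk of a data-dependent function that vanishes on its sample. -/
theorem lintegral_exp_risk_le {Z : Type*} [MeasurableSpace Z] (μ : Measure Z)
    [IsProbabilityMeasure μ] {n : ℕ} (hn : 1 ≤ n) {M : ℝ} (hM : 1 ≤ M) {h : (Fin n → Z) → Z → ℝ}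
    (hmeas : Measurable fun p : (Fin n → Z) × Z => h p.1 p.2) (h0 : ∀ z u, 0 ≤ h z u)
    (hbd : ∀ᵐ z ∂(Measure.pi fun _ : Fin n => μ), ∀ᵐ u ∂μ, h z u ≤ M)
    (hemp : ∀ᵐ z ∂(Measure.pi fun _ : Fin n => μ), ∀ i, h z (z i) = 0) {K : ℕ}
    (hcov : ∀ᵐ w ∂(Measure.pi fun _ : Fin n => μ.prod μ), ∃ 𝒢 : Finset (Z → ℝ), 𝒢.card ≤ K ∧
      (∀ g ∈ 𝒢, ∀ i, (0 ≤ g (w i).1 ∧ g (w i).1 ≤ M) ∧ 0 ≤ g (w i).2 ∧ g (w i).2 ≤ M) ∧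
      ∀ σ, ∃ g ∈ 𝒢, ∀ i, |h (fun i => (swapPairs σ w i).1) (w i).1 - g (w i).1| ≤ 1 / n ∧
        |h (fun i => (swapPairs σ w i).1) (w i).2 - g (w i).2| ≤ 1 / n) :
    ∫⁻ z, ENNReal.ofReal (Real.exp (n * ∫ u, h z u / (3 * M) ∂μ))
      ∂(Measure.pi fun _ : Fin n => μ) ≤ ENNReal.ofReal (Real.exp 2 * K) := by
  have hM0 : 0 < M := by linarith
  -- The term on the first sample vanishes almost surely, so subtracting it with the large weight `1
  -- / M` is free. It is needed once the samples are swapped.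
  let Φ : (Fin n → Z) × (Fin n → Z) → ENNReal := fun p =>
    ENNReal.ofReal (Real.exp (∑ i, (h p.1 (p.2 i) / (3 * M) - h p.1 (p.1 i) / M)))
  have hΦ : Measurable Φ := by
    refine ENNReal.measurable_ofReal.comp (Real.measurable_exp.comp
      (Finset.measurable_fun_sum _ fun i _ => ?_))
    have e1 : Measurable fun p : (Fin n → Z) × (Fin n → Z) => h p.1 (p.2 i) :=
      hmeas.comp (measurable_fst.prodMk ((measurable_pi_apply i).comp measurable_snd))
    have e2 : Measurable fun p : (Fin n → Z) × (Fin n → Z) => h p.1 (p.1 i) :=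
      hmeas.comp (measurable_fst.prodMk ((measurable_pi_apply i).comp measurable_fst))
    exact (e1.div_const _).sub (e2.div_const _)
  calc ∫⁻ z, ENNReal.ofReal (Real.exp (n * ∫ u, h z u / (3 * M) ∂μ))
        ∂(Measure.pi fun _ : Fin n => μ)
      ≤ ∫⁻ z, ∫⁻ z', Φ (z, z') ∂(Measure.pi fun _ : Fin n => μ)
          ∂(Measure.pi fun _ : Fin n => μ) := by
        refine lintegral_mono_ae ?_
        filter_upwards [hbd, hemp] with z hz hz0
        have hm : Measurable fun u => h z u / (3 * M) :=
          (hmeas.comp (measurable_const.prodMk measurable_id)).div_const _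
        have := ofReal_exp_integral_le_lintegral_pi μ n hm (B := M / (3 * M)) (by
          filter_upwards [hz] with u hu
          rw [abs_of_nonneg (div_nonneg (h0 z u) (by positivity))]
          gcongr)
        simpa [Φ, hz0] using this
    _ = ∫⁻ p, Φ p ∂((Measure.pi fun _ : Fin n => μ).prod (Measure.pi fun _ : Fin n => μ)) :=
        (lintegral_prod _ hΦ.aemeasurable).symm
    _ ≤ ENNReal.ofReal (Real.exp 2 * K) := by
        refine lintegral_prod_pi_le_of_swap μ hΦ ?_
        filter_upwards [hcov] with w hw
        obtain ⟨𝒢, hK, hb, hc⟩ := hw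
        have := sum_swap_exp_le_of_cover hn hM w 𝒢 (fun g hg i => (hb g hg i).1)
          (fun g hg i => (hb g hg i).2) (fun σ => h fun i => (swapPairs σ w i).1) hc
        have hle : (2 : ℝ) ^ n * (Real.exp 2 * 𝒢.card) ≤ 2 ^ n * (Real.exp 2 * K) := by
          gcongr
        have e := ENNReal.ofReal_le_ofReal (this.trans hle)
        rw [ENNReal.ofReal_sum_of_nonneg fun _ _ => (Real.exp_pos _).le,
          ENNReal.ofReal_mul (by positivity), ENNReal.ofReal_pow (by norm_num)] at e
        simpa [Φ] using e

/-! ### The constant in the rate -/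

theorem exists_rate_const (A d : ℕ) {M : ℝ} (hM : 1 ≤ M) :
    ∃ C : ℝ, 0 < C ∧ ∀ n : ℕ, 1 ≤ n → ∀ δ : ℝ, 0 < δ → δ < 1 →
      M ≤ C * (1 + Real.sqrt (Real.log (1 / δ))) / Real.sqrt n ∨
      Real.exp 2 * (A * (A * ((n + n) * n) + 1) ^ d : ℕ) ≤
        δ * Real.exp (n * (C * (1 + Real.sqrt (Real.log (1 / δ))) / Real.sqrt n / (3 * M))) := by
  have hM0 : 0 < M := by linarith
  set E : ℝ := 2 + A + d * (2 * A + 4) with hE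
  have hE0 : 0 ≤ E := by positivity
  refine ⟨3 * M * (E + 1), by positivity, fun n hn δ hδ hδ1 => ?_⟩
  have hn1 : (1 : ℝ) ≤ n := by exact_mod_cast hn
  have hr1 : 1 ≤ Real.sqrt n := Real.one_le_sqrt.2 hn1
  have hr2 : Real.sqrt n * Real.sqrt n = n := Real.mul_self_sqrt (by linarith)
  have hlog : 0 ≤ Real.log (1 / δ) := Real.log_nonneg (by rw [le_div_iff₀ hδ]; linarith)
  have hs0 := Real.sqrt_nonneg (Real.log (1 / δ))
  have hs2 : Real.sqrt (Real.log (1 / δ)) * Real.sqrt (Real.log (1 / δ)) = Real.log (1 / δ) :=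
    Real.mul_self_sqrt hlog
  have hδs : δ = Real.exp (-Real.log (1 / δ)) := by
    rw [one_div, Real.log_inv, neg_neg, Real.exp_log hδ]
  rw [← hs2] at hδs
  set s := Real.sqrt (Real.log (1 / δ))
  set r := Real.sqrt (n : ℝ)
  have hr0 : 0 < r := by linarith
  -- If `√n ≤ √(log (1/δ))`, the bound already exceeds the largest possible loss. Otherwise `s * s ≤
  -- s * r`, so the exponent `(E + 1) * (1 + s) * r` covers both `log (1/δ)` and the logarithm of
  -- the cover size, which is at most `E * r`.
  rcases le_total r s with hrs | hrs
  · left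
    rw [le_div_iff₀ hr0]
    nlinarith [mul_nonneg hM0.le hE0, mul_nonneg (mul_nonneg hM0.le hE0) hs0]
  · right
    have hexp : (n : ℝ) * (3 * M * (E + 1) * (1 + s) / r / (3 * M)) = (E + 1) * (1 + s) * r := by
      rw [← hr2]
      field_simp
    have hbase : ((A * ((n + n) * n) + 1 : ℕ) : ℝ) ≤ Real.exp ((2 * A + 4) * r) := by
      have h1 : r ≤ Real.exp r := by linarith [Real.add_one_le_exp r]
      have h2 : (n : ℝ) * n ≤ Real.exp (4 * r) := by
        calc (n : ℝ) * n = r ^ 4 := by rw [← hr2]; ring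
          _ ≤ Real.exp r ^ 4 := pow_le_pow_left₀ hr0.le h1 4
          _ = Real.exp (4 * r) := by rw [← Real.exp_nat_mul]; norm_num
      have h3 : (2 * A + 1 : ℝ) ≤ Real.exp (2 * A * r) := by
        have := Real.add_one_le_exp (2 * A * r)
        have hA : (0 : ℝ) ≤ A := Nat.cast_nonneg A
        nlinarith
      calc ((A * ((n + n) * n) + 1 : ℕ) : ℝ) ≤ (2 * A + 1) * (n * n) := by
            push_cast
            nlinarith
        _ ≤ Real.exp (2 * A * r) * Real.exp (4 * r) :=
            mul_le_mul h3 h2 (by positivity) (Real.exp_pos _).le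
        _ = Real.exp ((2 * A + 4) * r) := by rw [← Real.exp_add]; ring_nf
    have hA : (A : ℝ) ≤ Real.exp A := by linarith [Real.add_one_le_exp (A : ℝ)]
    have hδexp : δ * Real.exp ((E + 1) * (1 + s) * r) =
        Real.exp (-(s * s) + (E + 1) * (1 + s) * r) := by
      rw [Real.exp_add, ← hδs]
    rw [hexp, hδexp]
    calc Real.exp 2 * (A * (A * ((n + n) * n) + 1) ^ d : ℕ)
        = Real.exp 2 * (A * ((A * ((n + n) * n) + 1 : ℕ) : ℝ) ^ d) := by push_cast; ring
      _ ≤ Real.exp 2 * (Real.exp A * Real.exp ((2 * A + 4) * r) ^ d) := by gcongr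
      _ = Real.exp (2 + A + d * ((2 * A + 4) * r)) := by
          rw [← Real.exp_nat_mul, ← Real.exp_add, ← Real.exp_add]
          ring_nf
      _ ≤ _ := by
          refine Real.exp_le_exp.2 ?_
          have h1 : 2 + A + d * ((2 * A + 4) * r) ≤ E * r := by
            rw [hE]
            have : (0 : ℝ) ≤ A := Nat.cast_nonneg A
            nlinarith
          nlinarith [mul_nonneg (mul_nonneg hE0 hs0) hr0.le, mul_nonneg hs0 (sub_nonneg.2 hrs)]

/-! ### The observed law and the final bound -/

theorem isProbabilityMeasure_observedLaw {𝒳 : Type*} [MeasurableSpace 𝒳]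
    (P : Measure (𝒳 × ℝ × CandidateSet)) [IsProbabilityMeasure P] :
    IsProbabilityMeasure (observedLaw P) :=
  Measure.isProbabilityMeasure_map
    (measurable_fst.prodMk (measurable_snd.comp measurable_snd)).aemeasurable

theorem ae_observedLaw_iff {𝒳 : Type*} [MeasurableSpace 𝒳] (P : Measure (𝒳 × ℝ × CandidateSet))
    {p : 𝒳 × CandidateSet → Prop} (hp : MeasurableSet {u | p u}) :
    (∀ᵐ u ∂observedLaw P, p u) ↔ ∀ᵐ z ∂P, p (z.1, z.2.2) :=
  ae_map_iff (measurable_fst.prodMk (measurable_snd.comp measurable_snd)).aemeasurable hp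

/-- A model of zero risk has almost surely zero identification loss. -/
theorem ae_minLoss_eq_zero_of_risk_eq_zero {𝒳 : Type*} [MeasurableSpace 𝒳] {ℓ : ℝ → ℝ → ℝ}
    (hℓ : IsRegressionLoss ℓ) {𝒴 : Set ℝ} {P : Measure (𝒳 × ℝ × CandidateSet)}
    (hP : IsPLRLaw 𝒴 P) {f : 𝒳 → ℝ} (hf : Measurable f) {M : ℝ}
    (hM : ∀ x, ∀ y ∈ 𝒴, |ℓ (f x) y| ≤ M) (hrisk : risk ℓ P f = 0) :
    ∀ᵐ u ∂observedLaw P, minLoss ℓ (f u.1) u.2 = 0 := by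
  have := hP.isProbabilityMeasure
  have hm : Measurable fun z : 𝒳 × ℝ × CandidateSet => ℓ (f z.1) z.2.1 :=
    hℓ.continuous.measurable.comp
      ((hf.comp measurable_fst).prodMk (measurable_fst.comp measurable_snd))
  have hint : Integrable (fun z : 𝒳 × ℝ × CandidateSet => ℓ (f z.1) z.2.1) P := by
    refine Integrable.of_bound hm.aestronglyMeasurable M ?_
    filter_upwards [hP.ae_subset, hP.ae_mem] with z h1 h2
    exact hM _ _ (h1 _ h2)
  have h0 := (integral_eq_zero_iff_of_nonneg (fun z => hℓ.nonneg _ _) hint).1 hrisk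
  have hms : Measurable fun u : 𝒳 × CandidateSet => minLoss ℓ (f u.1) u.2 :=
    (measurable_minLoss hℓ.continuous).comp ((hf.comp measurable_fst).prodMk measurable_snd)
  rw [ae_observedLaw_iff P (p := fun u => minLoss ℓ (f u.1) u.2 = 0)
    (hms (measurableSet_singleton (0 : ℝ)))]
  filter_upwards [h0, hP.ae_mem] with z hz hy
  exact le_antisymm ((minLoss_le hy).trans_eq hz) (minLoss_nonneg hℓ.nonneg _ _)

/-- The closure appears because `𝒴` may be any set: containment of the candidates in a closed set is
a measurable event and so passes to the image law. Continuity of the loss later extends bounds from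
`𝒴` to its closure. -/
theorem IsPLRLaw.ae_observedLaw {𝒳 : Type*} [MeasurableSpace 𝒳] {𝒴 : Set ℝ}
    {P : Measure (𝒳 × ℝ × CandidateSet)} (hP : IsPLRLaw 𝒴 P) :
    ∀ᵐ u ∂observedLaw P, u.2.labels.Nonempty ∧ ∀ y ∈ u.2.labels, y ∈ closure 𝒴 := by
  rw [ae_observedLaw_iff P
    (p := fun u => u.2.labels.Nonempty ∧ ∀ y ∈ u.2.labels, y ∈ closure 𝒴)
    (measurable_snd (measurableSet_labels_nonempty.inter
      (measurableSet_labels_subset isClosed_closure)))]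
  filter_upwards [hP.ae_subset, hP.ae_mem] with z h1 h2
  exact ⟨⟨_, h2⟩, fun y hy => subset_closure (h1 y hy)⟩

theorem IsPLRLaw.nonempty {𝒳 : Type*} [MeasurableSpace 𝒳] {𝒴 : Set ℝ}
    {P : Measure (𝒳 × ℝ × CandidateSet)} (hP : IsPLRLaw 𝒴 P) : Nonempty 𝒳 ∧ 𝒴.Nonempty := by
  have := hP.isProbabilityMeasure
  obtain ⟨z, h1, h2⟩ := (hP.ae_subset.and hP.ae_mem).exists
  exact ⟨⟨z.1⟩, _, h1 _ h2⟩

theorem minLoss_mem_Icc {ℓ : ℝ → ℝ → ℝ} (hℓ : IsRegressionLoss ℓ) {𝒴 : Set ℝ} {a M : ℝ}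
    (ha : ∀ y ∈ 𝒴, ℓ a y ≤ M) {S : CandidateSet} (hS : S.labels.Nonempty)
    (hS𝒴 : ∀ y ∈ S.labels, y ∈ closure 𝒴) : 0 ≤ minLoss ℓ a S ∧ minLoss ℓ a S ≤ M := by
  obtain ⟨y, hy⟩ := hS
  have hcl : closure 𝒴 ⊆ {y | ℓ a y ≤ M} := closure_minimal ha
    (isClosed_le (hℓ.continuous.comp (by fun_prop : Continuous fun y : ℝ => (a, y)))
      continuous_const)
  exact ⟨minLoss_nonneg hℓ.nonneg _ _, (minLoss_le hy).trans (hcl (hS𝒴 y hy))⟩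

theorem abs_minLoss_sub_le {ℓ : ℝ → ℝ → ℝ} (hℓ : IsRegressionLoss ℓ) {𝒴 : Set ℝ} {a b η : ℝ}
    (hη : 0 ≤ η) (hab : ∀ y ∈ 𝒴, |ℓ a y - ℓ b y| ≤ η) {S : CandidateSet}
    (hS𝒴 : ∀ y ∈ S.labels, y ∈ closure 𝒴) : |minLoss ℓ a S - minLoss ℓ b S| ≤ η := by
  have hcl : closure 𝒴 ⊆ {y | |ℓ a y - ℓ b y| ≤ η} := closure_minimal hab
    (isClosed_le ((hℓ.continuous.comp (by fun_prop : Continuous fun y : ℝ => (a, y))).sub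
      (hℓ.continuous.comp (by fun_prop : Continuous fun y : ℝ => (b, y)))).abs continuous_const)
  have h1 := minLoss_le_minLoss_add (ℓ := ℓ) (a := a) (b := b) hη fun y hy => hcl (hS𝒴 y hy)
  have h2 := minLoss_le_minLoss_add (ℓ := ℓ) (a := b) (b := a) hη fun y hy => by
    rw [abs_sub_comm]
    exact hcl (hS𝒴 y hy)
  rw [abs_le]
  constructor <;> linarith

theorem theorem2 {𝒳 : Type*} [MeasurableSpace 𝒳] (ℓ : ℝ → ℝ → ℝ) (hℓ : IsRegressionLoss ℓ)
    (𝒴 : Set ℝ) (F : Set (𝒳 → ℝ)) (hF : ∀ f ∈ F, Measurable f)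
    (hdim : pseudoDim (lossClass ℓ F 𝒴) < ⊤)
    (M : ℝ) (hM : ∀ f ∈ F, ∀ x : 𝒳, ∀ y ∈ 𝒴, |ℓ (f x) y| ≤ M) :
    ∃ C : ℝ, 0 < C ∧
      ∀ P : Measure (𝒳 × ℝ × CandidateSet), IsPLRLaw 𝒴 P →
      ∀ fstar : 𝒳 → ℝ, IsArgMin (risk ℓ P) F fstar → risk ℓ P fstar = 0 →
      ∀ n : ℕ, 1 ≤ n →
      ∀ fhat : (Fin n → 𝒳 × CandidateSet) → 𝒳 → ℝ,
        Measurable (fun p : (Fin n → 𝒳 × CandidateSet) × 𝒳 => fhat p.1 p.2) →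
        (∀ᵐ z ∂(Measure.pi fun _ : Fin n => observedLaw P),
          IsArgMin (empMinRisk ℓ z) F (fhat z)) →
      ∀ δ : ℝ, 0 < δ → δ < 1 →
        (Measure.pi fun _ : Fin n => observedLaw P)
          {z | C * (1 + Real.sqrt (Real.log (1 / δ))) / Real.sqrt n <
            |minRisk ℓ P (fhat z) - minRisk ℓ P fstar|} ≤ ENNReal.ofReal δ := by
  classical
  -- If one of these is empty, no admissible `P` and `fstar` exist, and any constant serves.
  by_cases hne : Nonempty 𝒳 ∧ 𝒴.Nonempty ∧ F.Nonempty
  swap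
  · refine ⟨1, one_pos, fun P hP fstar hfs => ?_⟩
    exact absurd ⟨hP.nonempty.1, hP.nonempty.2, fstar, hfs.1⟩ hne
  obtain ⟨hX, h𝒴, hFne⟩ := hne
  -- The exponential estimates require a loss bound of at least `1`.
  set B := max M 1 with hBdef
  have hB1 : 1 ≤ B := le_max_right _ _
  have hB0 : 0 < B := by linarith
  have hbd : ∀ f ∈ F, ∀ x : 𝒳, ∀ y ∈ 𝒴, ℓ (f x) y ≤ B := fun f hf x y hy =>
    (le_abs_self _).trans ((hM f hf x y hy).trans (le_max_left _ _))
  obtain ⟨A, d, hcover⟩ := hℓ.exists_cover h𝒴 hdim hbd hFne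
  obtain ⟨C, hC, hrate⟩ := exists_rate_const A d hB1
  refine ⟨C, hC, fun P hP fstar hfs hrisk n hn fhat hfhat herm δ hδ hδ1 => ?_⟩
  have hprobP := hP.isProbabilityMeasure
  have hprob := isProbabilityMeasure_observedLaw P
  have hstar := ae_minLoss_eq_zero_of_risk_eq_zero hℓ hP (hF _ hfs.1) (hM _ hfs.1) hrisk
  have hcand := hP.ae_observedLaw
  set μ := observedLaw P with hμ
  let h : (Fin n → 𝒳 × CandidateSet) → 𝒳 × CandidateSet → ℝ := fun z u =>
    minLoss ℓ (fhat z u.1) u.2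
  have hmeas : Measurable fun p : (Fin n → 𝒳 × CandidateSet) × (𝒳 × CandidateSet) => h p.1 p.2 :=
    (measurable_minLoss hℓ.continuous).comp
      ((hfhat.comp (measurable_fst.prodMk (measurable_fst.comp measurable_snd))).prodMk
        (measurable_snd.comp measurable_snd))
  have h0 : ∀ z u, 0 ≤ h z u := fun z u => minLoss_nonneg hℓ.nonneg _ _
  have hle : ∀ᵐ z ∂(Measure.pi fun _ : Fin n => μ), ∀ᵐ u ∂μ, h z u ≤ B := by
    filter_upwards [herm] with z hz
    filter_upwards [hcand] with u hu
    exact (minLoss_mem_Icc hℓ (hbd _ hz.1 u.1) hu.1 hu.2).2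
  have hemp : ∀ᵐ z ∂(Measure.pi fun _ : Fin n => μ), ∀ i, h z (z i) = 0 := by
    filter_upwards [herm, ae_pi_forall μ hstar] with z hz hz0
    have h1 := hz.2 fstar hfs.1
    have hn0 : (0 : ℝ) < 1 / n := by
      have : (0 : ℝ) < n := by exact_mod_cast hn
      positivity
    have h2 : ∑ i, h z (z i) ≤ 0 := by
      have h3 : (1 / (n : ℝ)) * ∑ i, h z (z i) ≤ 0 := by
        simpa [empMinRisk, hz0, h] using h1
      nlinarith
    intro i
    exact le_antisymm
      ((Finset.single_le_sum (f := fun i => h z (z i)) (fun j _ => h0 z (z j))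
        (Finset.mem_univ i)).trans h2) (h0 _ _)
  have hexp := lintegral_exp_risk_le μ hn hB1 hmeas h0 hle hemp
    (K := A * (A * ((n + n) * n) + 1) ^ d) (by
      have hpairs : ∀ᵐ p ∂μ.prod μ,
          (p.1.2.labels.Nonempty ∧ ∀ y ∈ p.1.2.labels, y ∈ closure 𝒴) ∧
          (p.2.2.labels.Nonempty ∧ ∀ y ∈ p.2.2.labels, y ∈ closure 𝒴) :=
        (Measure.quasiMeasurePreserving_fst.ae hcand).and
          (Measure.quasiMeasurePreserving_snd.ae hcand)
      filter_upwards [ae_pi_forall (μ.prod μ) hpairs, ae_forall_swapPairs μ herm] with w hw hσ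
      -- The cover is taken on all `2n` points at resolution `n`. It depends on `w` only, hence
      -- serves the estimators of all swaps at once.
      obtain ⟨F₀, hF₀, hcard, hclose⟩ := hcover n hn (Fin n ⊕ Fin n)
        (Sum.elim (fun i => (w i).1.1) fun i => (w i).2.1)
      refine ⟨F₀.image fun f u => minLoss ℓ (f u.1) u.2,
        Finset.card_image_le.trans (by simpa using hcard), ?_, fun σ => ?_⟩
      · intro g hg i
        obtain ⟨f, hf, rfl⟩ := Finset.mem_image.1 hg
        exact ⟨minLoss_mem_Icc hℓ (hbd f (hF₀ hf) _) (hw i).1.1 (hw i).1.2,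
          minLoss_mem_Icc hℓ (hbd f (hF₀ hf) _) (hw i).2.1 (hw i).2.2⟩
      · obtain ⟨g, hg, hgc⟩ := hclose _ (hσ σ).1
        refine ⟨_, Finset.mem_image_of_mem _ hg, fun i => ⟨?_, ?_⟩⟩
        · exact abs_minLoss_sub_le hℓ (by positivity) (hgc (Sum.inl i)) (hw i).1.2
        · exact abs_minLoss_sub_le hℓ (by positivity) (hgc (Sum.inr i)) (hw i).2.2)
  have hRstar : minRisk ℓ P fstar = 0 := integral_eq_zero_of_ae hstar
  have hR : ∀ z, minRisk ℓ P (fhat z) = ∫ u, h z u ∂μ := fun z => rfl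
  have hRabs : ∀ z, |minRisk ℓ P (fhat z) - minRisk ℓ P fstar| = ∫ u, h z u ∂μ := fun z => by
    rw [hRstar, sub_zero, hR, abs_of_nonneg (integral_nonneg (h0 z))]
  simp_rw [hRabs]
  rcases hrate n hn δ hδ hδ1 with hbig | hsmall
  · have hnull : (Measure.pi fun _ : Fin n => μ)
        {z | C * (1 + Real.sqrt (Real.log (1 / δ))) / Real.sqrt n < ∫ u, h z u ∂μ} = 0 := by
      refine measure_eq_zero_iff_ae_notMem.2 ?_
      filter_upwards [hle] with z hz
      have : ∫ u, h z u ∂μ ≤ ∫ _u, B ∂μ :=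
        integral_mono_of_nonneg (Filter.Eventually.of_forall (h0 z)) (integrable_const B) hz
      simp only [integral_const, probReal_univ, smul_eq_mul, one_mul] at this
      exact not_lt.2 (this.trans hbig)
    rw [hnull]
    exact zero_le
  · set τ := C * (1 + Real.sqrt (Real.log (1 / δ))) / Real.sqrt n
    have hm : Measurable fun z => ∫ u, h z u / (3 * B) ∂μ :=
      ((hmeas.div_const (3 * B)).stronglyMeasurable.integral_prod_right').measurable
    have hme : Measurable fun z => ENNReal.ofReal (Real.exp (n * ∫ u, h z u / (3 * B) ∂μ)) :=
      (hm.const_mul _).exp.ennreal_ofReal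
    calc (Measure.pi fun _ : Fin n => μ) {z | τ < ∫ u, h z u ∂μ}
        ≤ (Measure.pi fun _ : Fin n => μ) {z | ENNReal.ofReal (Real.exp (n * (τ / (3 * B)))) ≤
            ENNReal.ofReal (Real.exp (n * ∫ u, h z u / (3 * B) ∂μ))} := by
          refine measure_mono fun z hz => ?_
          have hz' : τ < ∫ u, h z u ∂μ := hz
          refine ENNReal.ofReal_le_ofReal (Real.exp_le_exp.2 ?_)
          rw [integral_div]
          gcongr
      _ ≤ (∫⁻ z, ENNReal.ofReal (Real.exp (n * ∫ u, h z u / (3 * B) ∂μ))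
            ∂(Measure.pi fun _ : Fin n => μ)) / ENNReal.ofReal (Real.exp (n * (τ / (3 * B)))) :=
          meas_ge_le_lintegral_div hme.aemeasurable
            (ENNReal.ofReal_pos.2 (Real.exp_pos _)).ne' ENNReal.ofReal_ne_top
      _ ≤ ENNReal.ofReal δ := by
          refine ENNReal.div_le_of_le_mul (hexp.trans ?_)
          rw [← ENNReal.ofReal_mul hδ.le]
          exact ENNReal.ofReal_le_ofReal hsmall
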